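/- Consider matching markets with $n$ applicants and $n$ institutions. A type $t_a$ of an applicant $a$ is a strict ordering over some subset of the institutions; each institution has a strict priority order over all applicants; an outcome is a partial one-to-one matching. For fixed priorities, $\mathrm{DA}$ is the social choice function that maps a preference profile $t=(t_a)_a$ to the matching produced by applicant-proposing deferred acceptance. The menu of applicant $i$ with respect to $t_{-i}$ is the set of all partners (an institution, or "unmatched") that $i$ gets in $\mathrm{DA}(t_i',t_{-i})$ for some type $t_i'$. An extensive-form description is a finite directed graph with a single source, whose vertices are organized into layers $1,\dots,L$ so that every edge goes from some layer $j$ to layer $j+1$. Every vertex $v$ with at least two outgoing edges queries an applicant $a$ (a vertex with one outgoing edge may query an applicant or nobody) and has a transition function from types of $a$ to edges leaving $v$. The evaluation path on $t$ starts at the source and follows at every vertex that queries $a$ the edge given by $t_a$, and at a vertex that queries nobody its only outgoing edge, until it reaches a sink. Its memory requirement is $\log_2$ of the maximum number of vertices in a layer. It is applicant-proposing if for every evaluation path, every applicant $a$ and every $j$, the transition function of the $j$-th vertex on the path that queries $a$ depends only on the $j$-th institution on $a$'s list (or on the fact that the list has fewer than $j$ institutions). It is an individualized dictatorship description of $\mathrm{DA}$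 for applicant $i$ if its sinks are labeled by matchings such that the sink reached on each $t$ is labeled $\mathrm{DA}(t)$, and for some layer $k\in\{1,\dots,L\}$: no vertex before layer $k$ is a sink or queries $i$; and every vertex $v$ in layer $k$ queries $i$ and is labeled by a set which equals the menu of $i$ with respect to $t_{-i}$ whenever $v$ is on the evaluation path on $t$. Theorem. For every $n$ and every applicant $i$ there exist institution priorities (depending on $n$ and $i$) such that the following holds. (1) Any applicant-proposing individualized dictatorship extensive-form description of $\mathrm{DA}$ for $i$ requires $\Omega(n^2)$ memory: there are constants $c>0$ and $N$, independent of $i$ and of the description, such that for all $n\ge N$ its memory requirement is at least $cn^2$. (2) Hence, no applicant-linear individualized dictatorship description of $\mathrm{DA}$ for $i$ exists: for any choice of an applicant $i_n$ for each $n\geq 1$, there is no family $(D_n)_n$ of applicant-proposing extensive-form descriptions with memory requirement $O(n\log^{\alpha}n)$ for some constant $\alpha$ such that $D_n$ is an individualized dictatorship description of $\mathrm{DA}$ for $i_n$ for infinitely many $n$. -/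

import Mathlib

/-! ### Matching environments with `n` applicants and `n` institutions -/

/-- A type of an applicant: a strict ordering over some subset of the institutions (the acceptable
ones), written as a list without repetitions, favorite institution first. -/
abbrev PrefList (n : ℕ) : Type := {l : List (Fin n) // l.Nodup}

/-- A preference profile: one type for every applicant. -/
abbrev PrefProfile (n : ℕ) : Type := Fin n → PrefList n

/-- A strict priority order over all applicants for every institution: `prio h a` is the rank of
applicant `a` at institution `h`, where rank `0` is the top priority. -/
abbrev Priorities (n : ℕ) : Type := Fin n → Equiv.Perm (Fin n)

/-- A partial (one-to-one) matching of applicants to institutions; `partner a = none` means that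
applicant `a` is unmatched. -/
@[ext]
structure PartialMatching (n : ℕ) where
  partner : Fin n → Option (Fin n)
  injective_of_some : ∀ a b h, partner a = some h → partner b = some h → a = b

/-! ### Applicant-proposing deferred acceptance -/

/-- A state of the deferred acceptance algorithm: `rejections a` is the number of institutions that
have rejected applicant `a` so far (so these are the first `rejections a` entries of her list), and
`held h` is the applicant tentatively matched to institution `h`. -/
structure DAState (n : ℕ) where
  rejections : Fin n → ℕ
  held : Fin n → Option (Fin n)

/-- Initially nobody has been rejected and every institution is free. -/
def DAState.init (n : ℕ) : DAState n where
  rejections := fun _ => 0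
  held := fun _ => none

/-- Applicant `a` can propose: she is currently unmatched and has not exhausted her list. -/
def DAState.CanPropose {n : ℕ} (t : PrefProfile n) (σ : DAState n) (a : Fin n) : Prop :=
  (∀ h, σ.held h ≠ some a) ∧ σ.rejections a < (t a).1.length

instance {n : ℕ} (t : PrefProfile n) (σ : DAState n) (a : Fin n) :
    Decidable (σ.CanPropose t a) := by
  unfold DAState.CanPropose
  infer_instance

/-- The result of a proposal by `a` to `h`: of `a` and the applicant held so far (if any),
institution `h` holds the one of higher priority and rejects the other one. -/
def DAState.propose {n : ℕ} (prio : Priorities n) (σ : DAState n) (a h : Fin n) : DAState n :=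
  match σ.held h with
  | none => { σ with held := Function.update σ.held h (some a) }
  | some b =>
    if prio h a < prio h b then
      { rejections := Function.update σ.rejections b (σ.rejections b + 1)
        held := Function.update σ.held h (some a) }
    else
      { σ with rejections := Function.update σ.rejections a (σ.rejections a + 1) }

/-- One step of deferred acceptance: an unmatched applicant who has not exhausted her list (the
first one in the indexing; the final matching does not depend on this choice) proposes to her
favorite institution that has not yet rejected her. If there is no such applicant, nothing
changes. -/
def DAState.step {n : ℕ} (prio : Priorities n) (t : PrefProfile n) (σ : DAState n) : DAState n :=
  match (List.finRange n).find? (fun a => decide (σ.CanPropose t a)) with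
  | none => σ
  | some a =>
    match (t a).1[σ.rejections a]? with
    | none => σ
    | some h => σ.propose prio a h

/-- The state in which deferred acceptance stops. Every step increases the number of rejections
plus the number of matched institutions, so `n * n + n` steps suffice; see `daFinal_terminal`. -/
def daFinal {n : ℕ} (prio : Priorities n) (t : PrefProfile n) : DAState n :=
  (DAState.step prio t)^[n * n + n] (DAState.init n)

/-- The social choice function DA (applicant-proposing deferred acceptance) for fixed priorities:
the tentative matches become final when no more proposals can be made. -/
def DA {n : ℕ} (prio : Priorities n) (t : PrefProfile n) : PartialMatching n where
  partner a := (List.finRange n).find? (fun h => decide ((daFinal prio t).held h = some a))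
  injective_of_some := by
    intro a b h ha hb
    have ha' := List.find?_some ha
    have hb' := List.find?_some hb
    simp only [decide_eq_true_eq] at ha' hb'
    exact Option.some.inj (ha'.symm.trans hb')

/-- The number of rejections plus the number of matched institutions. -/
def DAState.progress {n : ℕ} (σ : DAState n) : ℕ :=
  ∑ a, σ.rejections a + ∑ h, (if (σ.held h).isSome then 1 else 0)

/-- An invariant of the algorithm, used to show that it has stopped. -/
def DAState.Valid {n : ℕ} (t : PrefProfile n) (σ : DAState n) : Prop :=
  (∀ a, σ.rejections a ≤ (t a).1.length) ∧
    (∀ h a, σ.held h = some a → σ.rejections a < (t a).1.length) ∧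
    ∀ h h' a, σ.held h = some a → σ.held h' = some a → h = h'

theorem DAState.valid_propose {n : ℕ} (prio : Priorities n) (t : PrefProfile n) (σ : DAState n)
    (a h : Fin n) (hσ : σ.Valid t) (ha : σ.CanPropose t a) : (σ.propose prio a h).Valid t := by
  obtain ⟨h1, h2, h3⟩ := hσ
  obtain ⟨ha1, ha2⟩ := ha
  have hu : ∀ h₁ h₂ c, Function.update σ.held h (some a) h₁ = some c →
      Function.update σ.held h (some a) h₂ = some c → h₁ = h₂ := by
    intro h₁ h₂ c e₁ e₂
    simp only [Function.update_apply] at e₁ e₂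
    grind
  unfold DAState.propose
  split
  · refine ⟨h1, fun h' b hb => ?_, hu⟩
    simp only [Function.update_apply] at hb
    grind
  · split
    · refine ⟨fun c => ?_, fun h' c hc => ?_, hu⟩
      · simp only [Function.update_apply]
        grind
      · simp only [Function.update_apply] at hc ⊢
        grind
    · refine ⟨fun c => ?_, fun h' c hc => ?_, h3⟩
      · simp only [Function.update_apply]
        grind
      · simp only [Function.update_apply] at hc ⊢
        grind

theorem DAState.progress_propose {n : ℕ} (prio : Priorities n) (σ : DAState n) (a h : Fin n) :
    (σ.propose prio a h).progress = σ.progress + 1 := by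
  have key : ∀ (f : Fin n → ℕ) (x : Fin n), ∑ y, Function.update f x (f x + 1) y = ∑ y, f y + 1 := by
    intro f x
    rw [Finset.sum_update_of_mem (Finset.mem_univ x),
      ← Finset.add_sum_erase Finset.univ f (Finset.mem_univ x), Finset.sdiff_singleton_eq_erase]
    omega
  unfold DAState.propose DAState.progress
  split
  · rename_i e
    have : (fun y => if (Function.update σ.held h (some a) y).isSome then 1 else 0)
        = Function.update (fun y => if (σ.held y).isSome then 1 else 0) h
          ((fun y => if (σ.held y).isSome then 1 else 0) h + 1) := by
      funext y
      by_cases hy : y = h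
      · subst hy
        simp [e]
      · simp [Function.update_of_ne hy]
    simp only [this, key]
    omega
  · rename_i b e
    split
    · have : (fun y => if (Function.update σ.held h (some a) y).isSome then 1 else 0)
          = (fun y => if (σ.held y).isSome then 1 else 0) := by
        funext y
        by_cases hy : y = h
        · subst hy
          simp [e]
        · simp [Function.update_of_ne hy]
      simp only [this, key]
      omega
    · simp only [key]
      omega

theorem DAState.progress_le {n : ℕ} (t : PrefProfile n) (σ : DAState n) (hσ : σ.Valid t) :
    σ.progress ≤ n * n + n := by
  unfold DAState.progress
  have h1 : ∑ a, σ.rejections a ≤ ∑ _a : Fin n, n := Finset.sum_le_sum fun a _ =>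
    (hσ.1 a).trans (by simpa using (t a).2.length_le_card)
  have h2 : ∑ h, (if (σ.held h).isSome then 1 else 0) ≤ ∑ _h : Fin n, 1 :=
    Finset.sum_le_sum fun h _ => by split <;> simp
  simp only [Finset.sum_const, Finset.card_univ, Fintype.card_fin, smul_eq_mul, mul_one] at h1 h2
  omega

/-- In the state in which the algorithm is stopped, no more proposals can be made. -/
theorem daFinal_terminal {n : ℕ} (prio : Priorities n) (t : PrefProfile n) (a : Fin n) :
    ¬ (daFinal prio t).CanPropose t a := by
  have main : ∀ m, ((DAState.step prio t)^[m] (DAState.init n)).Valid t ∧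
      ((∀ b, ¬ ((DAState.step prio t)^[m] (DAState.init n)).CanPropose t b) ∨
        m ≤ ((DAState.step prio t)^[m] (DAState.init n)).progress ∧
        ∃ b, ((DAState.step prio t)^[m] (DAState.init n)).CanPropose t b) := by
    intro m
    induction m with
    | zero =>
      refine ⟨⟨by simp [DAState.init], by simp [DAState.init], by simp [DAState.init]⟩, ?_⟩
      by_cases hb : ∃ b, (DAState.init n).CanPropose t b
      · exact Or.inr ⟨Nat.zero_le _, hb⟩
      · exact Or.inl (not_exists.mp hb)
    | succ m ih =>
      rw [Function.iterate_succ_apply']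
      generalize (DAState.step prio t)^[m] (DAState.init n) = σ at ih ⊢
      obtain ⟨hv, hs⟩ := ih
      rcases e : (List.finRange n).find? (fun a => decide (σ.CanPropose t a)) with _ | b
      · have hst : DAState.step prio t σ = σ := by simp [DAState.step, e]
        have hno : ∀ b, ¬ σ.CanPropose t b := by simpa using e
        rw [hst]
        exact ⟨hv, Or.inl hno⟩
      · have hb : σ.CanPropose t b := by simpa using List.find?_some e
        have hst : DAState.step prio t σ = σ.propose prio b ((t b).1[σ.rejections b]'hb.2) := by
          simp [DAState.step, e, List.getElem?_eq_getElem hb.2]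
        rw [hst]
        refine ⟨σ.valid_propose prio t b _ hv hb, ?_⟩
        rcases hs with hs | ⟨hs, -⟩
        · exact absurd hb (hs b)
        · rw [DAState.progress_propose]
          by_cases hc : ∃ c, (σ.propose prio b ((t b).1[σ.rejections b]'hb.2)).CanPropose t c
          · exact Or.inr ⟨by omega, hc⟩
          · exact Or.inl (not_exists.mp hc)
  obtain ⟨hv, hs | ⟨hs, b, hb⟩⟩ := main (n * n + n)
  · exact hs a
  · exfalso
    have hp := DAState.progress_le t _ (DAState.valid_propose prio t _ b b hv hb)
    rw [DAState.progress_propose] at hp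
    omega

/-! ### Extensive-form descriptions -/

/-- An extensive-form description for `n` players whose types are preference lists: a finite
layered directed graph whose vertices query the types of the players.

`out v` is the set of heads of the edges that leave `v`. A vertex with at least two outgoing edges
has to query a player; a vertex with exactly one outgoing edge may query a player or nobody; a sink
queries nobody. `trans v` is the transition function of a vertex that queries a player. (At a vertex
that queries nobody it carries no information: it takes the unique outgoing edge, if there is
one.) -/
structure ExtensiveFormDescription (n : ℕ) where
  V : Type
  [fintypeV : Fintype V]
  numLayers : ℕ
  layer : V → ℕ
  layer_mem : ∀ v, 1 ≤ layer v ∧ layer v ≤ numLayers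
  out : V → Set V
  layer_of_mem_out : ∀ v, ∀ w ∈ out v, layer w = layer v + 1
  source : V
  layer_source : layer source = 1
  source_iff : ∀ v, (∀ u, v ∉ out u) ↔ v = source
  query : V → Option (Fin n)
  out_subsingleton_of_query_eq_none : ∀ v, query v = none → (out v).Subsingleton
  out_nonempty_of_query_eq_some : ∀ v i, query v = some i → (out v).Nonempty
  trans : V → PrefList n → V
  trans_mem_out : ∀ v s, (out v).Nonempty → trans v s ∈ out v

namespace ExtensiveFormDescription

variable {n : ℕ} (D : ExtensiveFormDescription n)

/-- A sink: a vertex without outgoing edges. -/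
def IsSink (v : D.V) : Prop := D.out v = ∅

open Classical in
/-- The vertex that follows `v` on the evaluation path on `t`: a vertex that queries player `i`
applies its transition function to `t i`, and a vertex that queries nobody follows its unique
outgoing edge. We stay at a sink. -/
noncomputable def next (t : PrefProfile n) (v : D.V) : D.V :=
  if D.IsSink v then v
  else
    match D.query v with
    | some i => D.trans v (t i)
    | none => D.trans v ⟨[], List.nodup_nil⟩

/-- The vertex reached after `m` steps on the evaluation path on `t`; it is in layer `m + 1`,
unless the path has reached a sink before. -/
noncomputable def path (t : PrefProfile n) (m : ℕ) : D.V := (D.next t)^[m] D.source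

/-- The vertex `v` is on the evaluation path on `t`. -/
def OnPath (t : PrefProfile n) (v : D.V) : Prop := ∃ m, D.path t m = v

/-- The description is an outcome description of the social choice function `f`: sinks can be
labeled by outcomes so that the sink on the evaluation path on `t` always has label `f t`. -/
def IsOutcomeDescription (f : PrefProfile n → PartialMatching n) : Prop :=
  ∃ label : D.V → PartialMatching n, ∀ t v, D.OnPath t v → D.IsSink v → label v = f t

/-- The number of vertices querying player `i` among the first `m` vertices of the evaluation path
on `t`. -/
noncomputable def queryCount (t : PrefProfile n) (i : Fin n) (m : ℕ) : ℕ :=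
  ((Finset.range m).filter (fun m' => D.query (D.path t m') = some i)).card

/-- The description is applicant-proposing: on every evaluation path and for every applicant `i`,
the transition function of the `j`-th vertex on the path that queries `i` depends only on the `j`-th
institution on the list of `i` (or on the fact that the list has fewer than `j` institutions).
Positions are counted from `0`, so the vertex at step `m` of the path is the one with index
`queryCount t i m`. -/
def IsApplicantProposing : Prop :=
  ∀ (t : PrefProfile n) (i : Fin n) (m : ℕ), D.query (D.path t m) = some i →
    ∀ s s' : PrefList n, s.1[D.queryCount t i m]? = s'.1[D.queryCount t i m]? →
      D.trans (D.path t m) s = D.trans (D.path t m) s'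

/-- The memory requirement: the logarithm in base `2` of the maximum number of vertices in a
layer. -/
noncomputable def memory : ℝ :=
  letI := D.fintypeV
  Real.logb 2 (((Finset.Icc 1 D.numLayers).sup
    (fun j => (Finset.univ.filter (fun v : D.V => D.layer v = j)).card) : ℕ) : ℝ)

end ExtensiveFormDescription

/-- The menu of player `i` with respect to the types of the other players in `t`: all `i`-outcomes
(partners of `i`, or `none`) that `i` gets for some report of hers. The value `t i` is irrelevant. -/
def menu {n : ℕ} (f : PrefProfile n → PartialMatching n) (i : Fin n) (t : PrefProfile n) :
    Set (Option (Fin n)) :=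
  {x | ∃ s : PrefList n, (f (Function.update t i s)).partner i = x}

/-- `D` is an individualized dictatorship (extensive-form) description of `f` for player `i`: it is
an outcome description of `f` with a layer `k` such that no path ends before layer `k` and no vertex
before layer `k` queries `i`, while every vertex of layer `k` queries `i` and is labeled by the menu
of `i` for every type profile whose evaluation path visits it. -/
def ExtensiveFormDescription.IsIndividualizedDictatorship {n : ℕ} (D : ExtensiveFormDescription n)
    (f : PrefProfile n → PartialMatching n) (i : Fin n) : Prop :=
  D.IsOutcomeDescription f ∧
  ∃ k, 1 ≤ k ∧ k ≤ D.numLayers ∧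
    (∀ v, D.layer v < k → ¬ D.IsSink v ∧ D.query v ≠ some i) ∧
    (∀ v, D.layer v = k → D.query v = some i) ∧
    ∃ menuLabel : D.V → Set (Option (Fin n)),
      ∀ t v, D.layer v = k → D.OnPath t v → menuLabel v = menu f i t

/-- A family of extensive-form descriptions, one for every market size `n`, is applicant-linear: all
of them are applicant-proposing, and the memory requirement is `O(n * (log n) ^ k)` for some
constant `k`. -/
def IsApplicantLinear (D : (n : ℕ) → ExtensiveFormDescription n) : Prop :=
  (∀ n, (D n).IsApplicantProposing) ∧
  ∃ k : ℕ, (fun n => (D n).memory) =O[Filter.atTop] (fun n : ℕ => (n : ℝ) * Real.log n ^ k)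

/-! The applicants of a suitable market encode an `m × m` matrix of bits, row `j` being the list of
one applicant, encoder `j`. An institution `gate j` is on the menu of the distinguished applicant
unless encoder `j` continues her list by one more institution. An applicant-proposing description
reads every list once and from the front, so before it knows the menu it must have read all rows to
their ends. But row `j` influences the matching if the distinguished applicant then chooses
`gate j`, so the vertex at which she is queried has to remember all `m ^ 2` bits. With `m` about
`n / 4` this takes memory of order `n ^ 2`, which is not `O(n log ^ k n)`. -/

namespace PrefList

/-- An applicant with list `l` strictly prefers the institution `h` to the outcome `x`. An
institution that is not on `l` has index `l.1.length`, so every listed one is preferred to it. -/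
def Prefers {n : ℕ} (l : PrefList n) (h : Fin n) (x : Option (Fin n)) : Prop :=
  h ∈ l.1 ∧ ∀ h' ∈ x, l.1.idxOf h < l.1.idxOf h'

end PrefList

/-- A stable matching: every applicant lists her partner, and an institution that an applicant
prefers to her outcome is matched to somebody of higher priority. -/
structure PartialMatching.IsStable {n : ℕ} (prio : Priorities n) (t : PrefProfile n)
    (μ : PartialMatching n) : Prop where
  mem_of_partner : ∀ {a h}, μ.partner a = some h → h ∈ (t a).1
  exists_of_prefers : ∀ {a h}, (t a).Prefers h (μ.partner a) →
    ∃ b, μ.partner b = some h ∧ prio h b < prio h a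

theorem PartialMatching.IsStable.exists_of_partner_eq_none {n : ℕ} {prio : Priorities n}
    {t : PrefProfile n} {μ : PartialMatching n} (hμ : μ.IsStable prio t) {a h : Fin n}
    (ha : μ.partner a = none) (hh : h ∈ (t a).1) :
    ∃ b, μ.partner b = some h ∧ prio h b < prio h a :=
  hμ.exists_of_prefers ⟨hh, by simp [ha]⟩

section DeferredAcceptance

variable {n : ℕ} {prio : Priorities n} {t : PrefProfile n}

namespace DAState

/-- The invariant behind stability: held applicants are at the current position of their lists, and
every institution that has rejected an applicant holds somebody of higher priority. -/
structure Consistent (prio : Priorities n) (t : PrefProfile n) (σ : DAState n) : Prop where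
  getElem?_of_held : ∀ {h a}, σ.held h = some a → (t a).1[σ.rejections a]? = some h
  exists_held_of_rejected : ∀ {a p h}, p < σ.rejections a → (t a).1[p]? = some h →
    ∃ b, σ.held h = some b ∧ prio h b < prio h a

theorem consistent_init : (init n).Consistent prio t := by
  constructor <;> simp [init]

variable {σ : DAState n}

theorem Consistent.propose_cases (hσ : σ.Consistent prio t) {a h : Fin n} (ha : σ.CanPropose t a)
    (hah : (t a).1[σ.rejections a]? = some h) :
    (σ.held h = none ∧
      σ.propose prio a h = { σ with held := Function.update σ.held h (some a) }) ∨
    ∃ winner loser, prio h winner < prio h loser ∧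
      (t winner).1[σ.rejections winner]? = some h ∧ (t loser).1[σ.rejections loser]? = some h ∧
      (∀ b, σ.held h = some b → prio h winner ≤ prio h b) ∧
      σ.propose prio a h =
        { rejections := Function.update σ.rejections loser (σ.rejections loser + 1)
          held := Function.update σ.held h (some winner) } := by
  rcases hh : σ.held h with _ | b
  · exact .inl ⟨rfl, by simp only [propose, hh]⟩
  have hb := hσ.getElem?_of_held hh
  have hab : a ≠ b := fun e => ha.1 h (e ▸ hh)
  right
  rcases lt_or_gt_of_ne ((prio h).injective.ne hab) with hlt | hlt
  · exact ⟨a, b, hlt, hah, hb, by simpa using hlt.le, by simp only [propose, hh, if_pos hlt]⟩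
  · have hheld : Function.update σ.held h (some b) = σ.held := by rw [← hh, Function.update_eq_self]
    exact ⟨b, a, hlt, hb, hah, by simp, by simp only [propose, hh, if_neg hlt.not_gt, hheld]⟩

theorem Consistent.propose (hσ : σ.Consistent prio t) {a h : Fin n} (ha : σ.CanPropose t a)
    (hah : (t a).1[σ.rejections a]? = some h) : (σ.propose prio a h).Consistent prio t := by
  obtain ⟨hfree, e⟩ | ⟨winner, loser, hlt, hw, hl, hbest, e⟩ := hσ.propose_cases ha hah <;> rw [e]
  · refine ⟨fun {h' b} hb => ?_, fun {b p h'} hp hb => ?_⟩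
    · grind [Function.update_apply, hσ.getElem?_of_held]
    · obtain ⟨c, hc, hcb⟩ := hσ.exists_held_of_rejected hp hb
      exact ⟨c, by grind [Function.update_apply], hcb⟩
  · refine ⟨fun {h' b} hb => ?_, fun {b p h'} hp hb => ?_⟩
    · grind [Function.update_apply, hσ.getElem?_of_held]
    · obtain ⟨rfl, rfl⟩ | hp' : b = loser ∧ p = σ.rejections loser ∨ p < σ.rejections b := by
        grind [Function.update_apply]
      · obtain rfl : h = h' := by simpa [hl] using hb
        exact ⟨winner, by simp, hlt⟩
      · obtain ⟨c, hc, hcb⟩ := hσ.exists_held_of_rejected hp' hb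
        by_cases hh : h' = h
        · subst hh
          exact ⟨winner, by simp, (hbest c hc).trans_lt hcb⟩
        · exact ⟨c, by simpa [Function.update_of_ne hh] using hc, hcb⟩

end DAState

theorem daFinal_induction {motive : DAState n → Prop} (init : motive (DAState.init n))
    (propose : ∀ σ a h, motive σ → σ.CanPropose t a → (t a).1[σ.rejections a]? = some h →
      motive (σ.propose prio a h)) :
    motive (daFinal prio t) := by
  refine Function.Iterate.rec motive init (fun σ hσ => ?_) _
  unfold DAState.step
  split
  · exact hσ
  · rename_i a ha
    split
    · exact hσ
    · rename_i h hh
      exact propose σ a h hσ (by simpa using List.find?_some ha) hh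

theorem consistent_daFinal : (daFinal prio t).Consistent prio t :=
  daFinal_induction DAState.consistent_init fun _ _ _ hσ => hσ.propose

theorem DA_partner_eq_some_iff {a h : Fin n} :
    (DA prio t).partner a = some h ↔ (daFinal prio t).held h = some a := by
  refine ⟨fun e => by simpa using List.find?_some e, fun hh => ?_⟩
  have hsome : ((DA prio t).partner a).isSome := by
    simpa [DA] using ⟨h, hh⟩
  obtain ⟨h', e⟩ := Option.isSome_iff_exists.mp hsome
  have hh' : (daFinal prio t).held h' = some a := by simpa using List.find?_some e
  rw [e, ← consistent_daFinal.getElem?_of_held hh', consistent_daFinal.getElem?_of_held hh]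

theorem DA_partner_eq_getElem? (a : Fin n) :
    (DA prio t).partner a = (t a).1[(daFinal prio t).rejections a]? := by
  rcases e : (DA prio t).partner a with _ | h
  · have hfree : ∀ h, (daFinal prio t).held h ≠ some a := fun h hh => by
      simp [DA_partner_eq_some_iff.mpr hh] at e
    have hlen := fun hlt => daFinal_terminal prio t a ⟨hfree, hlt⟩
    exact (List.getElem?_eq_none (not_lt.mp hlen)).symm
  · exact (consistent_daFinal.getElem?_of_held (DA_partner_eq_some_iff.mp e)).symm

theorem isStable_DA : (DA prio t).IsStable prio t where
  mem_of_partner {a h} e := List.mem_of_getElem? (DA_partner_eq_getElem? a ▸ e)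
  exists_of_prefers {a h} := by
    rintro ⟨hmem, hpref⟩
    have hidx : (t a).1.idxOf h < (daFinal prio t).rejections a := by
      by_contra! hle
      have hlt := hle.trans_lt (List.idxOf_lt_length_of_mem hmem)
      have := hpref _ (by rw [DA_partner_eq_getElem?, List.getElem?_eq_getElem hlt]; rfl)
      rw [(t a).2.idxOf_getElem] at this
      omega
    obtain ⟨b, hb, hlt⟩ :=
      consistent_daFinal.exists_held_of_rejected hidx (List.getElem?_idxOf hmem)
    exact ⟨b, DA_partner_eq_some_iff.mpr hb, hlt⟩

/-- Nobody in `C` is ever rejected: to displace a member from her first choice takes a member that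
has already been rejected by her own. -/
theorem DA_partner_eq_head? {C : Set (Fin n)}
    (hC : ∀ x ∈ C, ∀ y h, (t x).1.head? = some h → h ∈ (t y).1 → prio h y < prio h x →
      y ∈ C ∧ (t y).1.head? ≠ some h) {x : Fin n} (hx : x ∈ C) :
    (DA prio t).partner x = (t x).1.head? := by
  have key : (daFinal prio t).Consistent prio t ∧ ∀ x ∈ C, (daFinal prio t).rejections x = 0 := by
    refine daFinal_induction
      (motive := fun σ => σ.Consistent prio t ∧ ∀ x ∈ C, σ.rejections x = 0)
      ⟨DAState.consistent_init, by simp [DAState.init]⟩ ?_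
    rintro σ a h ⟨hσ, hrej⟩ ha hah
    refine ⟨hσ.propose ha hah, fun x hx => ?_⟩
    obtain ⟨-, e⟩ | ⟨winner, loser, hlt, hw, hl, -, e⟩ := hσ.propose_cases ha hah <;> rw [e]
    · exact hrej x hx
    · suffices hne : x ≠ loser by simpa [Function.update_of_ne hne] using hrej x hx
      rintro rfl
      rw [hrej x hx, ← List.head?_eq_getElem?] at hl
      obtain ⟨hwC, hhead⟩ := hC x hx winner h hl (List.mem_of_getElem? hw) hlt
      rw [hrej winner hwC, ← List.head?_eq_getElem?] at hw
      exact hhead hw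
  rw [DA_partner_eq_getElem?, key.2 x hx, List.head?_eq_getElem?]

end DeferredAcceptance

namespace ExtensiveFormDescription

variable {n : ℕ} (D : ExtensiveFormDescription n)

theorem logb_card_le_memory_of_injective {X : Type*} [Fintype X] [Nonempty X] {F : X → D.V}
    (hF : Function.Injective F) {j : ℕ} (hj : ∀ x, D.layer (F x) = j) :
    Real.logb 2 (Fintype.card X) ≤ D.memory := by
  classical
  let := D.fintypeV
  have hmem : j ∈ Finset.Icc 1 D.numLayers :=
    Finset.mem_Icc.mpr (hj (Classical.arbitrary X) ▸ D.layer_mem _)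
  have hcard : Fintype.card X ≤ (Finset.univ.filter fun v : D.V => D.layer v = j).card := by
    rw [← Finset.card_univ, ← Finset.card_image_of_injective _ hF]
    exact Finset.card_le_card (by simp [Finset.subset_iff, hj])
  refine Real.logb_le_logb_of_le one_lt_two (by exact_mod_cast Fintype.card_pos) ?_
  exact_mod_cast hcard.trans (Finset.le_sup
    (f := fun j => (Finset.univ.filter fun v : D.V => D.layer v = j).card) hmem)

section Path

variable {D} {t t' : PrefProfile n} {m m' : ℕ}

theorem next_of_isSink {v : D.V} (hv : D.IsSink v) : D.next t v = v := if_pos hv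

theorem next_congr {v : D.V} (h : ∀ a, D.query v = some a → D.trans v (t a) = D.trans v (t' a)) :
    D.next t v = D.next t' v := by
  unfold next
  split_ifs
  · rfl
  · split
    · rename_i a ha
      exact h a ha
    · rfl

theorem layer_next {v : D.V} (hv : ¬ D.IsSink v) : D.layer (D.next t v) = D.layer v + 1 := by
  apply D.layer_of_mem_out
  have hne : (D.out v).Nonempty := Set.nonempty_iff_ne_empty.mpr hv
  rw [next, if_neg hv]
  split <;> exact D.trans_mem_out _ _ hne

theorem path_succ : D.path t (m + 1) = D.next t (D.path t m) :=
  Function.iterate_succ_apply' ..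

theorem layer_path (h : ∀ k < m, ¬ D.IsSink (D.path t k)) : D.layer (D.path t m) = m + 1 := by
  induction m with
  | zero => exact D.layer_source
  | succ m ih => rw [path_succ, layer_next (h m m.lt_succ_self), ih fun k hk => h k (by omega)]

theorem IsSink.path_of_le (hs : D.IsSink (D.path t m)) (hm : m ≤ m') :
    D.IsSink (D.path t m') := by
  induction m', hm using Nat.le_induction with
  | base => exact hs
  | succ k _ ih => rwa [path_succ, next_of_isSink ih]

theorem isSink_path_of_numLayers_le (hm : D.numLayers ≤ m) : D.IsSink (D.path t m) := by
  by_contra hs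
  have hlayer := layer_path fun k hk h => hs (IsSink.path_of_le h hk.le)
  have := (D.layer_mem (D.path t m)).2
  omega

theorem queryCount_mono (a : Fin n) : Monotone (D.queryCount t a) := fun _ _ h =>
  Finset.card_le_card (Finset.filter_subset_filter _ (Finset.range_subset_range.mpr h))

theorem queryCount_lt {a : Fin n} (hq : D.query (D.path t m) = some a) (h : m < m') :
    D.queryCount t a m < D.queryCount t a m' := by
  refine lt_of_lt_of_le ?_ (queryCount_mono a h)
  simp [queryCount, Finset.range_add_one, Finset.filter_insert, hq]

theorem queryCount_congr (h : ∀ k < m, D.path t k = D.path t' k) (a : Fin n) :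
    D.queryCount t a m = D.queryCount t' a m :=
  congrArg Finset.card (Finset.filter_congr fun k hk => by rw [h k (Finset.mem_range.mp hk)])

end Path

namespace IsApplicantProposing

variable {D} {t t' : PrefProfile n} {M : ℕ}

theorem path_update (hD : D.IsApplicantProposing) {a : Fin n} {s : PrefList n}
    (hs : ∀ p < D.queryCount t a M, s.1[p]? = (t a).1[p]?) {m : ℕ} (hm : m ≤ M) :
    D.path (Function.update t a s) m = D.path t m := by
  induction m with
  | zero => rfl
  | succ m ih =>
    rw [path_succ, path_succ, ih (by omega)]
    refine next_congr fun b hb => ?_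
    obtain rfl | hba := eq_or_ne b a
    · rw [Function.update_self]
      exact hD t b m hb _ _ (hs _ (queryCount_lt hb hm))
    · rw [Function.update_of_ne hba]

theorem trans_eq_trans_nil (hD : D.IsApplicantProposing) {a : Fin n}
    (ha : (t a).1.length ≤ D.queryCount t a M) {m : ℕ} (hm : M ≤ m)
    (hq : D.query (D.path t m) = some a) :
    D.trans (D.path t m) (t a) = D.trans (D.path t m) ⟨[], List.nodup_nil⟩ :=
  hD t a m hq _ _ (by simpa using ha.trans (queryCount_mono a hm))

theorem path_eq_of_le (hD : D.IsApplicantProposing) (hM : D.path t M = D.path t' M)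
    (h : ∀ a, t a ≠ t' a →
      (t a).1.length ≤ D.queryCount t a M ∧ (t' a).1.length ≤ D.queryCount t' a M)
    {m : ℕ} (hm : M ≤ m) : D.path t m = D.path t' m := by
  induction m, hm using Nat.le_induction with
  | base => exact hM
  | succ m hm ih =>
    rw [path_succ, path_succ, ← ih]
    refine next_congr fun a ha => ?_
    by_cases e : t a = t' a
    · rw [e]
    · obtain ⟨hr, hr'⟩ := h a e
      rw [hD.trans_eq_trans_nil hr hm ha, ih, hD.trans_eq_trans_nil hr' hm (ih ▸ ha)]

end IsApplicantProposing

/-- The menu step of an individualized dictatorship description of `f` for player `i`: every path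
is still running after `M` steps, `i` has not been queried so far, and the vertex that has been
reached determines the menu of `i`. In terms of `IsIndividualizedDictatorship` this is
`k - 1`, as paths start in layer `1`. -/
structure IsMenuStep (f : PrefProfile n → PartialMatching n) (i : Fin n) (M : ℕ) : Prop where
  layer_path : ∀ t, D.layer (D.path t M) = M + 1
  queryCount_eq_zero : ∀ t, D.queryCount t i M = 0
  menu_eq : ∀ {t t'}, D.path t M = D.path t' M → menu f i t = menu f i t'

variable {D} {f : PrefProfile n → PartialMatching n} {i : Fin n}

theorem IsIndividualizedDictatorship.exists_isMenuStep
    (hf : D.IsIndividualizedDictatorship f i) : ∃ M, D.IsMenuStep f i M := by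
  obtain ⟨-, k, hk, -, hbefore, -, menuLabel, hlabel⟩ := hf
  have hlayer : ∀ t, ∀ m < k, D.layer (D.path t m) = m + 1 := by
    intro t m
    induction m with
    | zero => exact fun _ => D.layer_source
    | succ m ih =>
      intro hm
      have := ih (by omega)
      rw [path_succ, layer_next (hbefore _ (by omega)).1, this]
  refine ⟨k - 1, fun t => hlayer t _ (by omega), fun t => ?_, fun {t t'} e => ?_⟩
  · refine Finset.card_eq_zero.mpr (Finset.filter_eq_empty_iff.mpr fun m hm => ?_)
    have hm := Finset.mem_range.mp hm
    exact (hbefore _ (by rw [hlayer t m (by omega)]; omega)).2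
  · have hk' : ∀ t, D.layer (D.path t (k - 1)) = k := fun t => by
      rw [hlayer t _ (by omega)]; omega
    rw [← hlabel t _ (hk' t) ⟨_, rfl⟩, ← hlabel t' _ (hk' t) ⟨_, e.symm⟩]

namespace IsMenuStep

variable {M : ℕ} {t t' : PrefProfile n}

theorem path_update (hM : D.IsMenuStep f i M) (hD : D.IsApplicantProposing) (t : PrefProfile n)
    (s : PrefList n) {m : ℕ} (hm : m ≤ M) : D.path (Function.update t i s) m = D.path t m :=
  hD.path_update (by simp [hM.queryCount_eq_zero]) hm

theorem queryCount_update (hM : D.IsMenuStep f i M) (hD : D.IsApplicantProposing)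
    (t : PrefProfile n) (s : PrefList n) (a : Fin n) :
    D.queryCount (Function.update t i s) a M = D.queryCount t a M :=
  queryCount_congr (fun _ hk => hM.path_update hD t s hk.le) a

theorem length_le_queryCount (hM : D.IsMenuStep f i M) (hD : D.IsApplicantProposing) {a : Fin n}
    {s : PrefList n} (hs : (t a).1 <+: s.1)
    (hmenu : menu f i (Function.update t a s) ≠ menu f i t) :
    (t a).1.length ≤ D.queryCount t a M := by
  by_contra! hlt
  refine hmenu (hM.menu_eq (hD.path_update (fun p hp => ?_) le_rfl))
  obtain ⟨l, hl⟩ := hs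
  rw [← hl, List.getElem?_append_left (hp.trans hlt)]

theorem apply_update_eq (hM : D.IsMenuStep f i M) (hD : D.IsApplicantProposing)
    (hf : D.IsOutcomeDescription f) (hpath : D.path t M = D.path t' M)
    (h : ∀ a, t a ≠ t' a →
      (t a).1.length ≤ D.queryCount t a M ∧ (t' a).1.length ≤ D.queryCount t' a M)
    (s : PrefList n) : f (Function.update t i s) = f (Function.update t' i s) := by
  obtain ⟨label, hlabel⟩ := hf
  have hend : D.path (Function.update t i s) (M + D.numLayers) =
      D.path (Function.update t' i s) (M + D.numLayers) := by
    refine hD.path_eq_of_le ?_ (fun a ha => ?_) (Nat.le_add_right M _)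
    · rwa [hM.path_update hD t s le_rfl, hM.path_update hD t' s le_rfl]
    · have hai : a ≠ i := by
        rintro rfl
        simp at ha
      rw [Function.update_of_ne hai, Function.update_of_ne hai] at ha ⊢
      rw [hM.queryCount_update hD, hM.queryCount_update hD]
      exact h a ha
  have hsink : D.IsSink (D.path (Function.update t i s) (M + D.numLayers)) :=
    isSink_path_of_numLayers_le (Nat.le_add_left ..)
  rw [← hlabel _ _ ⟨_, rfl⟩ hsink, ← hlabel _ _ ⟨_, hend.symm⟩ hsink]

end IsMenuStep

/-- A fooling set argument: the profiles of the family `T` reach pairwise different vertices at the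
menu step, since the lists in which they differ have been read completely by then and can have an
influence on the outcome only through the vertex. -/
theorem IsIndividualizedDictatorship.logb_card_le_memory
    (hf : D.IsIndividualizedDictatorship f i) (hD : D.IsApplicantProposing)
    {X : Type*} [Fintype X] [Nonempty X] {T : X → PrefProfile n}
    (hmenu : ∀ x y a, T x a ≠ T y a → ∃ s : PrefList n, (T x a).1 <+: s.1 ∧
      menu f i (Function.update (T x) a s) ≠ menu f i (T x))
    (hinj : Function.Injective fun x s => f (Function.update (T x) i s)) :
    Real.logb 2 (Fintype.card X) ≤ D.memory := by
  obtain ⟨M, hM⟩ := hf.exists_isMenuStep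
  have hread : ∀ x y a, T x a ≠ T y a → (T x a).1.length ≤ D.queryCount (T x) a M := by
    intro x y a hne
    obtain ⟨s, hs, hmenu⟩ := hmenu x y a hne
    exact hM.length_le_queryCount hD hs hmenu
  refine D.logb_card_le_memory_of_injective (F := fun x => D.path (T x) M) (fun x y hxy => ?_)
    fun x => hM.layer_path (T x)
  refine hinj (funext fun s => ?_)
  exact hM.apply_update_eq hD hf.1 hxy (fun a hne => ⟨hread x y a hne, hread y x a hne.symm⟩) s

end ExtensiveFormDescription

theorem exists_perm_lt_of_lt {n : ℕ} {α : Type*} [LinearOrder α] (key : Fin n → α) :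
    ∃ π : Equiv.Perm (Fin n), ∀ a b, key a < key b → π a < π b := by
  refine ⟨(Tuple.sort key).symm, fun a b hab => ?_⟩
  by_contra! hle
  have := Tuple.monotone_sort key hle
  simp only [Function.comp_apply, Equiv.apply_symm_apply] at this
  exact this.not_gt hab

namespace BitMarket

/-- The roles of the applicants in the market that encodes `m * m` bits. Reporting `gate j`, the
distinguished applicant gets encoder `j` rejected there, who goes on to the flags on her list; each
flag `k` that she visits makes incumbent `k` and rival `k` exchange flag `k` and spare `k`, and then
rejects her. If her list ends with `trap j`, she displaces keeper `j`, who returns to `gate j` and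
evicts the distinguished applicant. -/
inductive Applicant (m : ℕ)
  | distinguished
  | encoder (j : Fin m)
  | keeper (j : Fin m)
  | incumbent (k : Fin m)
  | rival (k : Fin m)

/-- The roles of the institutions in the market that encodes `m * m` bits; see
`BitMarket.Applicant`. -/
inductive Institution (m : ℕ)
  | gate (j : Fin m)
  | trap (j : Fin m)
  | flag (k : Fin m)
  | spare (k : Fin m)

open Applicant Institution

/-- The priorities between the roles; the smallest rank has the top priority, and ties can be
broken arbitrarily. -/
def rank {m : ℕ} : Institution m → Applicant m → ℕ
  | gate _, keeper _ => 0
  | gate _, distinguished => 1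
  | trap _, encoder _ => 0
  | flag _, rival _ => 0
  | flag _, encoder _ => 1
  | spare _, incumbent _ => 0
  | _, _ => 2

/-- The lists that encode the bits `k ∈ S j`, where the distinguished applicant reports the gate `o`
only (or nothing). -/
noncomputable def prefs {m : ℕ} (S : Fin m → Finset (Fin m)) (o : Option (Fin m)) :
    Applicant m → List (Institution m)
  | distinguished => o.toList.map gate
  | encoder j => gate j :: (S j).toList.map flag
  | keeper j => [trap j, gate j]
  | incumbent k => [flag k, spare k]
  | rival k => [spare k, flag k]

section Roles

variable {m : ℕ} {S : Fin m → Finset (Fin m)}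

theorem nodup_prefs (S : Fin m → Finset (Fin m)) (o : Option (Fin m)) (r : Applicant m) :
    (prefs S o r).Nodup := by
  have hflag : Function.Injective (flag (m := m)) := fun _ _ => flag.inj
  cases r <;> cases o <;> simp [prefs, hflag, List.nodup_map_iff, Finset.nodup_toList]

/-- The applicants that get their first choice if the distinguished one reports `gate j`. -/
def Unaffected (S : Fin m → Finset (Fin m)) (j : Fin m) : Applicant m → Prop
  | distinguished => True
  | encoder j' => j' ≠ j
  | keeper _ => True
  | incumbent k => k ∉ S j
  | rival k => k ∉ S j

theorem Unaffected.of_rank_le {j : Fin m} {r r' : Applicant m} {h : Institution m}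
    (hr : Unaffected S j r) (hh : (prefs S (some j) r).head? = some h)
    (hh' : h ∈ prefs S (some j) r') (hne : r' ≠ r) (hrank : rank h r' ≤ rank h r) :
    Unaffected S j r' ∧ (prefs S (some j) r').head? ≠ some h := by
  cases r <;> cases r' <;> grind [prefs, rank, Unaffected, Finset.mem_toList]

end Roles

end BitMarket

/-- A copy of the market of `BitMarket.Applicant` inside a market with `n` applicants and `n`
institutions; it leaves the priorities between applicants of equal rank, and those of applicants
without a role, unspecified. -/
structure BitMarket (m : ℕ) {n : ℕ} (prio : Priorities n) where
  app : BitMarket.Applicant m ↪ Fin n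
  inst : BitMarket.Institution m ↪ Fin n
  prio_lt_prio : ∀ h r r', BitMarket.rank h r < BitMarket.rank h r' →
    prio (inst h) (app r) < prio (inst h) (app r')

namespace BitMarket

open Applicant Institution

variable {m n : ℕ} {prio : Priorities n} (B : BitMarket m prio)

/-- The profile in which the applicants with a role report `prefs S o` and all others nothing. -/
noncomputable def profile (S : Fin m → Finset (Fin m)) (o : Option (Fin m)) : PrefProfile n :=
  Function.extend B.app
    (fun r => ⟨(prefs S o r).map B.inst, (nodup_prefs S o r).map B.inst.injective⟩)
    fun _ => ⟨[], List.nodup_nil⟩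

variable (S : Fin m → Finset (Fin m)) (o : Option (Fin m))

theorem profile_app (r : Applicant m) : (B.profile S o (B.app r)).1 = (prefs S o r).map B.inst := by
  rw [profile, B.app.injective.extend_apply]

theorem profile_of_notMem_range {x : Fin n} (hx : x ∉ Set.range B.app) :
    (B.profile S o x).1 = [] := by
  rw [profile, Function.extend_apply' _ _ _ hx]

theorem exists_of_mem_profile {h : Institution m} {x : Fin n}
    (hx : B.inst h ∈ (B.profile S o x).1) : ∃ r, B.app r = x ∧ h ∈ prefs S o r := by
  obtain ⟨r, rfl⟩ : x ∈ Set.range B.app := by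
    by_contra hx'
    simp [B.profile_of_notMem_range S o hx'] at hx
  refine ⟨r, rfl, ?_⟩
  rwa [profile_app, List.mem_map_of_injective B.inst.injective] at hx

theorem profile_congr {o o' : Option (Fin m)} {S S' : Fin m → Finset (Fin m)} {x : Fin n}
    (h : ∀ r, B.app r = x → prefs S o r = prefs S' o' r) :
    B.profile S o x = B.profile S' o' x := by
  refine Subtype.ext ?_
  by_cases hx : x ∈ Set.range B.app
  · obtain ⟨r, rfl⟩ := hx
    rw [profile_app, profile_app, h r rfl]
  · rw [B.profile_of_notMem_range _ _ hx, B.profile_of_notMem_range _ _ hx]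

theorem update_profile (j : Fin m) :
    Function.update (B.profile S none) (B.app distinguished)
        ⟨[B.inst (gate j)], List.nodup_singleton _⟩ = B.profile S (some j) := by
  refine Function.update_eq_iff.mpr ⟨Subtype.ext ?_, fun x hx => B.profile_congr fun r hr => ?_⟩
  · rw [profile_app]
    rfl
  · cases r with
    | distinguished => exact absurd hr.symm hx
    | _ => rfl

variable {S o}

theorem DA_partner_of_unaffected {j : Fin m} {r : Applicant m} (hr : Unaffected S j r) :
    (DA prio (B.profile S (some j))).partner (B.app r) =
      ((prefs S (some j) r).map B.inst).head? := by
  rw [← profile_app]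
  refine DA_partner_eq_head? (C := B.app '' {r | Unaffected S j r}) ?_ ⟨r, hr, rfl⟩
  rintro _ ⟨r, hr, rfl⟩ y h hh hy hlt
  rw [profile_app, List.head?_map, Option.map_eq_some_iff] at hh
  obtain ⟨h, hh, rfl⟩ := hh
  obtain ⟨r', rfl, hr'⟩ := B.exists_of_mem_profile S _ hy
  have hrank : rank h r' ≤ rank h r := not_lt.mp fun hlt' => hlt.asymm (B.prio_lt_prio _ _ _ hlt')
  have hne : r' ≠ r := by
    rintro rfl
    exact hlt.false
  obtain ⟨hunaff, hhead⟩ := hr.of_rank_le hh hr' hne hrank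
  exact ⟨⟨r', hunaff, rfl⟩, by simpa [profile_app] using hhead⟩

section Stable

variable {B} {t : PrefProfile n} {μ : PartialMatching n} {j : Fin m}

theorem partner_ne_none_of_rank_lt (hμ : μ.IsStable prio t) {r r' : Applicant m}
    {h : Institution m} (hh : B.inst h ∈ (t (B.app r)).1)
    (hr' : μ.partner (B.app r') = some (B.inst h)) (hrank : rank h r < rank h r') :
    μ.partner (B.app r) ≠ none := by
  intro hnone
  obtain ⟨b, hb, hlt⟩ := hμ.exists_of_partner_eq_none hnone hh
  rw [μ.injective_of_some _ _ _ hb hr'] at hlt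
  exact hlt.asymm (B.prio_lt_prio _ _ _ hrank)

theorem partner_eq_of_rank_lt (hμ : μ.IsStable prio t) {r r' : Applicant m}
    {g h : Institution m} (hr : ∀ x, x ∈ (t (B.app r)).1 ↔ x = B.inst g ∨ x = B.inst h)
    (hr' : μ.partner (B.app r') = some (B.inst h)) (hrank : rank h r < rank h r') :
    μ.partner (B.app r) = some (B.inst g) := by
  rcases e : μ.partner (B.app r) with _ | x
  · exact absurd e (partner_ne_none_of_rank_lt hμ ((hr _).mpr (.inr rfl)) hr' hrank)
  · obtain rfl | rfl := (hr x).mp (hμ.mem_of_partner e)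
    · rfl
    · obtain rfl := B.app.injective (μ.injective_of_some _ _ _ e hr')
      exact absurd hrank (lt_irrefl _)

variable (hincumbent : ∀ k, (t (B.app (incumbent k))).1 = [B.inst (flag k), B.inst (spare k)])
  (hrival : ∀ k, (t (B.app (rival k))).1 = [B.inst (spare k), B.inst (flag k)])

include hincumbent hrival

theorem partner_encoder_ne_flag (hμ : μ.IsStable prio t) (k : Fin m) :
    μ.partner (B.app (encoder j)) ≠ some (B.inst (flag k)) := by
  intro he
  have hspare : μ.partner (B.app (rival k)) = some (B.inst (spare k)) :=
    partner_eq_of_rank_lt hμ (by simp [hrival]) he (by simp [rank])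
  have hflag : μ.partner (B.app (incumbent k)) = some (B.inst (flag k)) :=
    partner_eq_of_rank_lt hμ (by simp [hincumbent]) hspare (by simp [rank])
  exact absurd (B.app.injective (μ.injective_of_some _ _ _ he hflag)) (by simp)

theorem partner_encoder_eq_none (hμ : μ.IsStable prio t)
    (hgate : μ.partner (B.app distinguished) = some (B.inst (gate j)))
    (htrap : μ.partner (B.app (keeper j)) = some (B.inst (trap j)))
    (hencoder : ∀ h ∈ (t (B.app (encoder j))).1,
      h = B.inst (gate j) ∨ h = B.inst (trap j) ∨ ∃ k, h = B.inst (flag k)) :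
    μ.partner (B.app (encoder j)) = none := by
  rcases e : μ.partner (B.app (encoder j)) with _ | h
  · rfl
  obtain rfl | rfl | ⟨k, rfl⟩ := hencoder h (hμ.mem_of_partner e)
  · exact absurd (B.app.injective (μ.injective_of_some _ _ _ e hgate)) (by simp)
  · exact absurd (B.app.injective (μ.injective_of_some _ _ _ e htrap)) (by simp)
  · exact absurd e (partner_encoder_ne_flag hincumbent hrival hμ k)

theorem partner_distinguished_ne_gate (hμ : μ.IsStable prio t)
    (hkeeper : (t (B.app (keeper j))).1 = [B.inst (trap j), B.inst (gate j)])
    (hencoder : (t (B.app (encoder j))).1 =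
      (prefs S o (encoder j) ++ [trap j]).map B.inst) :
    μ.partner (B.app distinguished) ≠ some (B.inst (gate j)) := by
  intro hgate
  have htrap : μ.partner (B.app (keeper j)) = some (B.inst (trap j)) :=
    partner_eq_of_rank_lt hμ (by simp [hkeeper]) hgate (by simp [rank])
  refine partner_ne_none_of_rank_lt hμ (h := trap j) (by simp [hencoder]) htrap (by simp [rank])
    (partner_encoder_eq_none hincumbent hrival hμ hgate htrap ?_)
  simp only [hencoder, prefs, List.mem_map, List.mem_append, List.mem_cons]
  grind

end Stable

theorem DA_partner_incumbent_eq_flag_iff {j k : Fin m} :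
    (DA prio (B.profile S (some j))).partner (B.app (incumbent k)) = some (B.inst (flag k)) ↔
      k ∉ S j := by
  refine ⟨fun hflag hk => ?_, fun hk => B.DA_partner_of_unaffected (r := incumbent k) hk⟩
  refine partner_ne_none_of_rank_lt isStable_DA (r := encoder j) ?_ hflag (by simp [rank]) ?_
  · simpa [profile_app, prefs] using hk
  · refine partner_encoder_eq_none (fun k => B.profile_app ..) (fun k => B.profile_app ..)
      isStable_DA (B.DA_partner_of_unaffected (r := distinguished) trivial)
      (B.DA_partner_of_unaffected (r := keeper j) trivial) ?_
    simp only [profile_app, prefs, List.map_cons, List.map_map, List.mem_cons, List.mem_map]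
    grind

theorem exists_menu_ne {S' : Fin m → Finset (Fin m)} {x : Fin n}
    (hx : B.profile S none x ≠ B.profile S' none x) :
    ∃ s : PrefList n, (B.profile S none x).1 <+: s.1 ∧
      menu (DA prio) (B.app distinguished) (Function.update (B.profile S none) x s) ≠
        menu (DA prio) (B.app distinguished) (B.profile S none) := by
  obtain ⟨j, rfl⟩ : ∃ j, B.app (encoder j) = x := by
    by_contra! h
    refine hx (B.profile_congr fun r hr => ?_)
    cases r with
    | encoder j => exact absurd hr (h j)
    | _ => rfl
  have hnodup : ((prefs S none (encoder j) ++ [trap j]).map B.inst).Nodup :=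
    .map B.inst.injective (by simpa [prefs, List.nodup_append] using nodup_prefs S none (encoder j))
  refine ⟨⟨_, hnodup⟩, by simp [profile_app], fun e => ?_⟩
  have hgate :
      some (B.inst (gate j)) ∈ menu (DA prio) (B.app distinguished) (B.profile S none) := by
    refine ⟨⟨[B.inst (gate j)], List.nodup_singleton _⟩, ?_⟩
    rw [update_profile]
    exact B.DA_partner_of_unaffected (r := distinguished) trivial
  obtain ⟨s, hs⟩ := e ▸ hgate
  refine partner_distinguished_ne_gate (S := S) (o := none) (fun k => ?_) (fun k => ?_)
    isStable_DA ?_ ?_ hs <;> simp [profile_app, prefs]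

theorem injective_DA_update_profile :
    Function.Injective fun (S : Fin m → Finset (Fin m)) s =>
      DA prio (Function.update (B.profile S none) (B.app distinguished) s) := by
  refine fun S S' e => funext fun j => Finset.ext fun k => not_iff_not.mp ?_
  have hj := congrFun e ⟨[B.inst (gate j)], List.nodup_singleton _⟩
  simp only [update_profile] at hj
  rw [← B.DA_partner_incumbent_eq_flag_iff, hj, B.DA_partner_incumbent_eq_flag_iff]

theorem sq_le_memory {D : ExtensiveFormDescription n} (hD : D.IsApplicantProposing)
    (hf : D.IsIndividualizedDictatorship (DA prio) (B.app distinguished)) :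
    (m : ℝ) ^ 2 ≤ D.memory := by
  have hmem := hf.logb_card_le_memory hD (T := fun S => B.profile S none)
    (fun _ _ _ => B.exists_menu_ne) B.injective_DA_update_profile
  have hcard : Fintype.card (Fin m → Finset (Fin m)) = 2 ^ m ^ 2 := by
    simp [sq, pow_mul]
  rwa [hcard, Nat.cast_pow, Nat.cast_ofNat, Real.logb_pow, Real.logb_self_eq_one one_lt_two,
    mul_one, Nat.cast_pow] at hmem

theorem exists_applicant_embedding (hn : 4 * m + 1 ≤ n) (i : Fin n) :
    ∃ app : Applicant m ↪ Fin n, app .distinguished = i := by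
  let code : Applicant m → ℕ
    | .distinguished => 0
    | .encoder j => 4 * j + 1
    | .keeper j => 4 * j + 2
    | .incumbent k => 4 * k + 3
    | .rival k => 4 * k + 4
  have hcode : ∀ r, code r < n := by
    intro r
    cases r <;> simp only [code] <;> omega
  have hinj : Function.Injective fun r => (⟨code r, hcode r⟩ : Fin n) := by
    intro r r' h
    cases r <;> cases r' <;> grind
  exact ⟨.trans ⟨_, hinj⟩ (Equiv.swap ⟨0, i.pos⟩ i).toEmbedding, Equiv.swap_apply_left ⟨0, i.pos⟩ i⟩

theorem nonempty_institution_embedding (hn : 4 * m ≤ n) : Nonempty (Institution m ↪ Fin n) := by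
  let code : Institution m → ℕ
    | .gate j => 4 * j
    | .trap j => 4 * j + 1
    | .flag k => 4 * k + 2
    | .spare k => 4 * k + 3
  have hcode : ∀ h, code h < n := by
    intro h
    cases h <;> simp only [code] <;> omega
  refine ⟨fun h => ⟨code h, hcode h⟩, fun h h' e => ?_⟩
  cases h <;> cases h' <;> grind

theorem exists_prio_market (hn : 4 * m + 1 ≤ n) (i : Fin n) :
    ∃ (prio : Priorities n) (B : BitMarket m prio), B.app .distinguished = i := by
  obtain ⟨app, happ⟩ := exists_applicant_embedding hn i
  obtain ⟨inst⟩ : Nonempty (Institution m ↪ Fin n) := nonempty_institution_embedding (by omega)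
  choose π hπ using fun h : Institution m =>
    exists_perm_lt_of_lt (Function.extend app (rank h) fun _ => 0)
  refine ⟨Function.extend inst π 1, ⟨app, inst, fun h r r' hlt => ?_⟩, happ⟩
  rw [inst.injective.extend_apply]
  apply hπ
  rwa [app.injective.extend_apply, app.injective.extend_apply]

end BitMarket

theorem exists_prio_sq_le_memory {n : ℕ} (i : Fin n) :
    ∃ prio : Priorities n, ∀ D : ExtensiveFormDescription n, D.IsApplicantProposing →
      D.IsIndividualizedDictatorship (DA prio) i → (((n - 1) / 4 : ℕ) : ℝ) ^ 2 ≤ D.memory := by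
  have hn : 4 * ((n - 1) / 4) + 1 ≤ n := by
    have := i.pos
    omega
  obtain ⟨prio, B, rfl⟩ := BitMarket.exists_prio_market hn i
  exact ⟨prio, fun D => B.sq_le_memory⟩

theorem isLittleO_mul_log_pow_sq (k : ℕ) :
    (fun n : ℕ => (n : ℝ) * Real.log n ^ k) =o[Filter.atTop] fun n : ℕ => (n : ℝ) ^ 2 := by
  simp only [sq]
  exact (Asymptotics.isBigO_refl _ _).mul_isLittleO
    (Real.isLittleO_pow_log_id_atTop.comp_tendsto tendsto_natCast_atTop_atTop)

theorem IsApplicantLinear.eventually_memory_lt {D : (n : ℕ) → ExtensiveFormDescription n}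
    (hD : IsApplicantLinear D) {c : ℝ} (hc : 0 < c) :
    ∀ᶠ n in Filter.atTop, (D n).memory < c * (n : ℝ) ^ 2 := by
  obtain ⟨-, k, hk⟩ := hD
  filter_upwards [(hk.trans_isLittleO (isLittleO_mul_log_pow_sq k)).bound (half_pos hc),
    Filter.eventually_gt_atTop 0] with n hn hpos
  have hsq : (0 : ℝ) < (n : ℝ) ^ 2 := by positivity
  calc (D n).memory ≤ ‖(D n).memory‖ := le_abs_self _
    _ ≤ c / 2 * (n : ℝ) ^ 2 := by rwa [Real.norm_of_nonneg hsq.le] at hn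
    _ < c * (n : ℝ) ^ 2 := by nlinarith

theorem theorem3 :
    ∃ prio : (n : ℕ) → Fin n → Priorities n,
      (∃ c : ℝ, 0 < c ∧ ∃ N : ℕ, ∀ n : ℕ, N ≤ n → ∀ (i : Fin n) (D : ExtensiveFormDescription n),
        D.IsApplicantProposing → D.IsIndividualizedDictatorship (DA (prio n i)) i →
          c * (n : ℝ) ^ 2 ≤ D.memory) ∧
      (∀ i : (n : ℕ) → 0 < n → Fin n, ¬ ∃ D : (n : ℕ) → ExtensiveFormDescription n,
        IsApplicantLinear D ∧
          ∃ᶠ n in Filter.atTop, ∃ hn : 0 < n,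
            (D n).IsIndividualizedDictatorship (DA (prio n (i n hn))) (i n hn)) := by
  choose prio hprio using @exists_prio_sq_le_memory
  have hbound : ∀ n, 5 ≤ n → ∀ (i : Fin n) (D : ExtensiveFormDescription n),
      D.IsApplicantProposing → D.IsIndividualizedDictatorship (DA (prio i)) i →
        1 / 64 * (n : ℝ) ^ 2 ≤ D.memory := by
    intro n hn i D hD hf
    have hle : (n : ℝ) ≤ 8 * ((n - 1) / 4 : ℕ) := by
      exact_mod_cast (by omega : n ≤ 8 * ((n - 1) / 4))
    refine le_trans ?_ (hprio i D hD hf)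
    nlinarith [pow_le_pow_left₀ n.cast_nonneg hle 2]
  refine ⟨fun _ => prio, ⟨1 / 64, by norm_num, 5, hbound⟩, ?_⟩
  rintro i ⟨D, hD, hfreq⟩
  have hsmall := hD.eventually_memory_lt (c := 1 / 64) (by norm_num)
  obtain ⟨n, ⟨hpos, hf⟩, hlt, hn⟩ :=
    (hfreq.and_eventually (hsmall.and (Filter.eventually_ge_atTop 5))).exists
  exact (hbound n hn _ (D n) (hD.1 n) hf).not_gt hlt
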